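/- Let $k$ be an algebraically closed field of characteristic zero, let $V$ be a $k$-vector space of finite dimension $d$, and let $\mathcal M = \mathrm{Hom}_k(V\otimes V, V)$ be the affine space of all (not necessarily associative) multiplications on $V$. For $a \in V$ let $L(a), R(a) : \mathcal M \to \mathcal M$ be the morphisms defined by $$L(a)m\,(v',v'') = m(v', m(a,v'')), \qquad R(a)m\,(v',v'') = m(m(v',a),v'').$$ For every nonzero $v \in V$ the morphisms $L(v)$ and $R(v)$ are dominant, and both have degree $2^d$: each of the extensions of function fields $k(\mathcal M)/L(v)^*k(\mathcal M)$ and $k(\mathcal M)/R(v)^*k(\mathcal M)$ has degree $2^d$, and for all $m'$ in a dense Zariski-open subset of $\mathcal M$ the fibres $L(v)^{-1}(m')$ and $R(v)^{-1}(m')$ consist of exactly $2^d$ points. -/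

import Mathlib

namespace AffineVar

section Basic

variable (k : Type*) [Field k] (W : Type*) [AddCommGroup W] [Module k W]

/-- The coordinate ring `k[W]` of a `k`-vector space `W` regarded as an affine space over an infinite
field `k`: the algebra of polynomial functions `W → k`, i.e. the algebra of functions generated by
the linear functionals. -/
def polyFun : Subalgebra k (W → k) :=
  Algebra.adjoin k (Set.range fun φ : Module.Dual k W => (φ : W → k))

/-- The Zariski topology on `W`, generated by the principal open sets `{w | f w ≠ 0}`,
`f ∈ k[W]`. -/
@[reducible] def zariski : TopologicalSpace W :=
  TopologicalSpace.generateFrom {U | ∃ f ∈ polyFun k W, U = {w | f w ≠ 0}}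

/-- A property holds for generic `w ∈ W` if it holds on a dense Zariski-open subset. -/
def Generically (P : W → Prop) : Prop :=
  ∃ U : Set W, @IsOpen W (zariski k W) U ∧ @Dense W (zariski k W) U ∧ ∀ w ∈ U, P w

variable {k W}

/-- A polynomial function restricted to a line is a polynomial in the parameter of the line. -/
theorem polyFun_line {f : W → k} (hf : f ∈ polyFun k W) (a b : W) :
    ∃ P : Polynomial k, ∀ t : k, f (a + t • b) = P.eval t := by
  unfold polyFun at hf
  induction hf using Algebra.adjoin_induction with
  | mem x hx =>
    obtain ⟨φ, rfl⟩ := hx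
    exact ⟨Polynomial.C (φ a) + Polynomial.C (φ b) * Polynomial.X, fun t => by
      simp only [map_add, map_smul, smul_eq_mul, Polynomial.eval_add, Polynomial.eval_mul,
        Polynomial.eval_C, Polynomial.eval_X]
      ring⟩
  | algebraMap r => exact ⟨Polynomial.C r, fun t => by simp⟩
  | add x y _ _ hx hy =>
    obtain ⟨P, hP⟩ := hx
    obtain ⟨Q, hQ⟩ := hy
    exact ⟨P + Q, fun t => by simp [hP, hQ]⟩
  | mul x y _ _ hx hy =>
    obtain ⟨P, hP⟩ := hx
    obtain ⟨Q, hQ⟩ := hy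
    exact ⟨P * Q, fun t => by simp [hP, hQ]⟩

instance polyFun_noZeroDivisors [Infinite k] : NoZeroDivisors (polyFun k W) where
  eq_zero_or_eq_zero_of_mul_eq_zero := by
    intro f g hfg
    by_contra! hne
    obtain ⟨hf, hg⟩ := hne
    have hf' : ∃ a, f.1 a ≠ 0 := by
      by_contra! h
      exact hf (Subtype.ext (funext h))
    have hg' : ∃ b, g.1 b ≠ 0 := by
      by_contra! h
      exact hg (Subtype.ext (funext h))
    obtain ⟨a, ha⟩ := hf'
    obtain ⟨b, hb⟩ := hg'
    obtain ⟨P, hP⟩ := polyFun_line f.2 a (b - a)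
    obtain ⟨Q, hQ⟩ := polyFun_line g.2 a (b - a)
    have hPQ : P * Q = 0 := by
      apply Polynomial.funext
      intro t
      have h := congrFun (congrArg Subtype.val hfg) (a + t • (b - a))
      simpa [hP, hQ] using h
    rcases mul_eq_zero.mp hPQ with h | h
    · apply ha
      have := hP 0
      simpa [h] using this
    · apply hb
      have := hQ 1
      simpa [h] using this

instance polyFun_isDomain [Infinite k] : IsDomain (polyFun k W) :=
  NoZeroDivisors.to_isDomain _

variable (k W) in
/-- The function field `k(W)`, the field of fractions of `k[W]`. -/
abbrev RatFun : Type _ := FractionRing (polyFun k W)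

end Basic

section Morphisms

variable (k : Type*) [Field k] (W W' : Type*) [AddCommGroup W] [Module k W]
  [AddCommGroup W'] [Module k W']

/-- A morphism of affine spaces `W → W'`: a map which pulls back polynomial functions to polynomial
functions. -/
structure Morphism where
  toFun : W → W'
  regular : ∀ f ∈ polyFun k W', f ∘ toFun ∈ polyFun k W

variable {k W W'}

/-- To check that a map is a morphism it suffices to pull back linear functionals. -/
theorem regular_of_dual (F : W → W')
    (h : ∀ φ : Module.Dual k W', (fun w => φ (F w)) ∈ polyFun k W) :
    ∀ f ∈ polyFun k W', f ∘ F ∈ polyFun k W := by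
  intro f hf
  unfold polyFun at hf
  induction hf using Algebra.adjoin_induction with
  | mem x hx =>
    obtain ⟨φ, rfl⟩ := hx
    exact h φ
  | algebraMap r => exact (polyFun k W).algebraMap_mem r
  | add x y _ _ hx hy => exact (polyFun k W).add_mem hx hy
  | mul x y _ _ hx hy => exact (polyFun k W).mul_mem hx hy

theorem dual_mem_polyFun (φ : Module.Dual k W) : (fun w => φ w) ∈ polyFun k W :=
  Algebra.subset_adjoin ⟨φ, rfl⟩

/-- Quadratic maps are morphisms. -/
theorem regular_of_bilinear [FiniteDimensional k W] (B : W →ₗ[k] W →ₗ[k] W') :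
    ∀ f ∈ polyFun k W', f ∘ (fun w => B w w) ∈ polyFun k W := by
  apply regular_of_dual
  intro φ
  let e := Module.finBasis k W
  have h : (fun w => φ (B w w)) =
      ∑ i, (fun w => e.coord i w) * (fun w => (φ ∘ₗ B (e i)) w) := by
    funext w
    have hw : B w w = ∑ i, e.coord i w • B (e i) w := by
      have h2 := congrArg (fun u => B u w) (e.sum_repr w)
      rw [← h2]
      simp only [map_sum, map_smul, LinearMap.sum_apply, LinearMap.smul_apply]
      rfl
    simp [hw]
  rw [h]
  exact (polyFun k W).sum_mem fun i _ =>
    (polyFun k W).mul_mem (dual_mem_polyFun _) (dual_mem_polyFun _)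

namespace Morphism

/-- The comorphism `F^* : k[W'] → k[W]`, `f ↦ f ∘ F`. -/
def comorphism (F : Morphism k W W') : polyFun k W' →+* polyFun k W where
  toFun f := ⟨f.1 ∘ F.toFun, F.regular f.1 f.2⟩
  map_one' := rfl
  map_mul' _ _ := rfl
  map_zero' := rfl
  map_add' _ _ := rfl

/-- A morphism is dominant if its image is Zariski-dense. -/
def IsDominant (F : Morphism k W W') : Prop :=
  @Dense W' (zariski k W') (Set.range F.toFun)

theorem IsDominant.comorphism_injective {F : Morphism k W W'} (hF : F.IsDominant) :
    Function.Injective F.comorphism := by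
  rw [injective_iff_map_eq_zero]
  intro f hf
  by_contra hne
  have hex : ∃ w, f.1 w ≠ 0 := by
    by_contra! h
    exact hne (Subtype.ext (funext h))
  have hopen : @IsOpen W' (zariski k W') {w | f.1 w ≠ 0} :=
    TopologicalSpace.isOpen_generateFrom_of_mem ⟨f.1, f.2, rfl⟩
  obtain ⟨_, hw, ⟨x, rfl⟩⟩ := (@Dense.inter_open_nonempty W' (zariski k W') _ hF) _ hopen hex
  exact hw (congrFun (congrArg Subtype.val hf) x)

variable [Infinite k]

/-- The field embedding `k(W') → k(W)` induced by a dominant morphism `W → W'`. -/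
noncomputable def pullback (F : Morphism k W W') (hF : F.IsDominant) :
    RatFun k W' →+* RatFun k W :=
  IsFractionRing.map (A := polyFun k W') (B := polyFun k W) hF.comorphism_injective

/-- The degree `[k(W) : k(W')]` of a dominant morphism `W → W'`
(with value `0` if this field extension is infinite). -/
noncomputable def degree (F : Morphism k W W') (hF : F.IsDominant) : ℕ :=
  @Module.finrank (RatFun k W') (RatFun k W) _ _ (F.pullback hF).toAlgebra.toModule

end Morphism

end Morphisms

end AffineVar

namespace Homotope

variable (k : Type*) [Field k] (V : Type*) [AddCommGroup V] [Module k V]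

/-- The space of multiplications on `V`: bilinear maps `V × V → V`. -/
abbrev Mult : Type _ := V →ₗ[k] V →ₗ[k] V

variable {k V}

/-- The left homotope `(v', v'') ↦ m (v', m (a, v''))` of the multiplication `m`. -/
def left (a : V) (m : Mult k V) : Mult k V := m.compl₂ (m a)

/-- The right homotope `(v', v'') ↦ m (m (v', a), v'')` of the multiplication `m`. -/
def right (a : V) (m : Mult k V) : Mult k V := m ∘ₗ m.flip a

theorem left_apply (a : V) (m : Mult k V) (x y : V) : left a m x y = m x (m a y) := rfl

theorem right_apply (a : V) (m : Mult k V) (x y : V) : right a m x y = m (m x a) y := rfl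

variable [FiniteDimensional k V]

/-- The morphism `L(a)` from the space of multiplications to itself. -/
def L (a : V) : AffineVar.Morphism k (Mult k V) (Mult k V) where
  toFun := left a
  regular := AffineVar.regular_of_bilinear
    (LinearMap.mk₂ k (fun m n : Mult k V => m.compl₂ (n a))
      (fun _ _ _ => by ext; simp) (fun _ _ _ => by ext; simp)
      (fun _ _ _ => by ext; simp) (fun _ _ _ => by ext; simp))

/-- The morphism `R(a)` from the space of multiplications to itself. -/
def R (a : V) : AffineVar.Morphism k (Mult k V) (Mult k V) where
  toFun := right a
  regular := AffineVar.regular_of_bilinear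
    (LinearMap.mk₂ k (fun m n : Mult k V => m ∘ₗ n.flip a)
      (fun _ _ _ => by ext; simp) (fun _ _ _ => by ext; simp)
      (fun _ _ _ => by ext; simp) (fun _ _ _ => by ext; simp))

end Homotope

/-! Write a multiplication as a map `x ↦ m x` into `End V`. Then `left v m = m'` means `m x * m v =
m' x` for all `x`. At `x = v` this says that `X = m v` is a square root of `m' v`; if `m' v` is
invertible, `X` determines `m` by `m x = m' x * X⁻¹`, and every square root arises. So the fibre is
the set of square roots of `m' v`, and for generic `m'` the endomorphism `m' v` has `d` distinct
nonzero eigenvalues, hence `2 ^ d` square roots, one for each choice of signs. Flipping arguments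
reduces `right` to `left`.

Nonempty generic fibres give dominance. The degree then follows from a general fact
(`Morphism.generically_ncard_fibre`): in characteristic zero, a dominant morphism between affine
spaces of equal dimension has generic fibres of cardinality equal to its degree. This rests on a
primitive element `θ`: after inverting one function on the target, points of a fibre correspond to
the roots of the specialised minimal polynomial of `θ`. -/

namespace Homotope

/-! ### Square roots of endomorphisms and fibres of the homotope maps. -/

section SquareRoots

variable {k V : Type*} [Field k] [AddCommGroup V] [Module k V]

/-- An endomorphism which is diagonal with distinct nonzero eigenvalues has exactly
`2 ^ dim V` square roots. -/
theorem ncard_sqrt_of_basis [IsAlgClosed k] [CharZero k] {ι : Type*} [Fintype ι]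
    (b : Module.Basis ι k V) (A : Module.End k V) (c : ι → k) (hc : Function.Injective c)
    (hc0 : ∀ i, c i ≠ 0) (hA : ∀ i, A (b i) = c i • b i) :
    {X : Module.End k V | X * X = A}.ncard = 2 ^ Fintype.card ι := by
  classical
  choose s hs using fun i => IsAlgClosed.exists_pow_nat_eq (c i) (n := 2) (by norm_num)
  have hs0 : ∀ i, s i ≠ 0 := fun i h => hc0 i (by rw [← hs i, h]; simp)
  let σ : (ι → Bool) → ι → k := fun ε i => if ε i then s i else -s i
  have hσ : ∀ ε i, σ ε i * σ ε i = c i := fun ε i => by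
    rw [← hs i]
    by_cases h : ε i <;> simp [σ, h] <;> ring
  let D : (ι → Bool) → Module.End k V := fun ε => b.constr k fun i => σ ε i • b i
  have hD : ∀ ε i, D ε (b i) = σ ε i • b i := fun ε i => by simp [D]
  have hinj : Function.Injective D := by
    intro ε δ h
    funext i
    have h1 : σ ε i • b i = σ δ i • b i := by rw [← hD, ← hD, h]
    have h2 : σ ε i = σ δ i := smul_left_injective k (b.ne_zero i) h1
    have h3 := hs0 i
    cases h4 : ε i <;> cases h5 : δ i <;> simp [σ, h4, h5] at h2 ⊢
    · exact h3 (neg_eq_self.mp h2)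
    · exact h3 (self_eq_neg.mp h2)
  have hrange : {X : Module.End k V | X * X = A} = Set.range D := by
    ext X
    constructor
    · intro (hX : X * X = A)
      -- A square root of `A` commutes with `A`, so it preserves the eigenlines of `A`.
      have hcomm : ∀ u, A (X u) = X (A u) := fun u => by rw [← hX]; rfl
      have heig : ∀ i, ∃ r : k, X (b i) = r • b i := by
        intro i
        have hcoord : ∀ j, j ≠ i → b.repr (X (b i)) j = 0 := by
          intro j hj
          have h1 : b.repr (A (X (b i))) j = c j * b.repr (X (b i)) j := by
            have h2 : b.coord j ∘ₗ A = c j • b.coord j := b.ext fun l => by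
              by_cases h : l = j <;> simp [hA, h]
            exact LinearMap.congr_fun h2 (X (b i))
          rw [hcomm, hA, map_smul, map_smul, Finsupp.smul_apply, smul_eq_mul] at h1
          by_contra h
          exact hj (hc (mul_right_cancel₀ h h1)).symm
        refine ⟨b.repr (X (b i)) i, ?_⟩
        conv_lhs => rw [← b.sum_repr (X (b i))]
        exact Finset.sum_eq_single i (fun j _ hj => by rw [hcoord j hj, zero_smul]) (by simp)
      choose r hr using heig
      have hsq : ∀ i, r i = s i ∨ r i = -s i := by
        intro i
        rw [← sq_eq_sq_iff_eq_or_eq_neg, hs]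
        apply smul_left_injective k (b.ne_zero i)
        change _ • b i = c i • b i
        rw [← hA, ← hX, Module.End.mul_apply, hr, map_smul, hr, smul_smul, sq]
      refine ⟨fun i => decide (r i = s i), b.ext fun i => ?_⟩
      rw [hD, hr]
      congr 1
      by_cases h : r i = s i
      · simp [σ, h]
      · simp only [σ, h, decide_false, Bool.false_eq_true, if_false]
        exact ((hsq i).resolve_left h).symm
    · rintro ⟨ε, rfl⟩
      exact b.ext fun i => by simp [hD, hA, smul_smul, hσ]
  rw [hrange, ← Nat.card_coe_set_eq, Nat.card_range_of_injective hinj]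
  simp

/-- An endomorphism with separable characteristic polynomial is diagonalisable with distinct
eigenvalues. -/
theorem exists_eigenbasis [IsAlgClosed k] [FiniteDimensional k V] (A : Module.End k V)
    (hA : A.charpoly.Separable) :
    ∃ (b : Module.Basis (Fin (Module.finrank k V)) k V) (c : Fin (Module.finrank k V) → k),
      Function.Injective c ∧ ∀ i, A (b i) = c i • b i := by
  classical
  have hcard : Fintype.card (A.charpoly.rootSet k) = Module.finrank k V := by
    rw [Polynomial.card_rootSet_eq_natDegree hA (IsAlgClosed.splits _),
      LinearMap.charpoly_natDegree]
  let e := (Fintype.equivFinOfCardEq hcard).symm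
  have heig : ∀ i, A.HasEigenvalue (e i : k) := fun i => by
    rw [Module.End.hasEigenvalue_iff_isRoot_charpoly]
    have := (e i).2
    rw [Polynomial.mem_rootSet] at this
    simpa using this.2
  choose u hu using fun i => (heig i).exists_hasEigenvector
  have hinj : Function.Injective fun i => (e i : k) := Subtype.val_injective.comp e.injective
  have hli := Module.End.eigenvectors_linearIndependent' A _ hinj u hu
  refine ⟨basisOfLinearIndependentOfCardEqFinrank' u hli (by simp), _, hinj, fun i => ?_⟩
  simpa using (hu i).apply_eq_smul

/-- The determinant condition excludes the eigenvalue `0`, whose two signs would coincide. -/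
theorem ncard_sqrt [IsAlgClosed k] [CharZero k] [FiniteDimensional k V] (A : Module.End k V)
    (hA : A.charpoly.Separable) (hdet : LinearMap.det A ≠ 0) :
    {X : Module.End k V | X * X = A}.ncard = 2 ^ Module.finrank k V := by
  obtain ⟨b, c, hc, hb⟩ := exists_eigenbasis A hA
  have hinj : Function.Injective A := by
    have := (LinearMap.isUnit_iff_isUnit_det A).mpr (isUnit_iff_ne_zero.mpr hdet)
    exact ((Module.End.isUnit_iff A).mp this).1
  rw [ncard_sqrt_of_basis b A c hc (fun i h => b.ne_zero i (hinj ?_)) hb, Fintype.card_fin]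
  rw [hb, h, zero_smul, map_zero]

/-- If `m' v` is invertible, the fibre of `L(v)` over `m'` is in bijection with the square roots of
`m' v`. -/
theorem ncard_left_fibre [FiniteDimensional k V] (v : V) (m' : Mult k V)
    (hdet : LinearMap.det (m' v) ≠ 0) :
    {m : Mult k V | left v m = m'}.ncard = {X : Module.End k V | X * X = m' v}.ncard := by
  obtain ⟨u, hu⟩ := (LinearMap.isUnit_iff_isUnit_det _).mpr (isUnit_iff_ne_zero.mpr hdet)
  -- Since `u = X * X`, the product `X * u⁻¹` is the inverse of `X`.
  have hX : ∀ X : Module.End k V, X * X = m' v → X * (X * ↑u⁻¹) = 1 ∧ (X * ↑u⁻¹) * X = 1 := by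
    intro X hX
    have h : X * (X * ↑u⁻¹) = 1 := by rw [← mul_assoc, hX, ← hu, Units.mul_inv]
    exact ⟨h, mul_eq_one_comm.mp h⟩
  refine Set.ncard_congr (fun m _ => m v) ?_ ?_ ?_
  · rintro m rfl
    rfl
  · intro m n hm hn (h : m v = n v)
    have hm' : ∀ x, m x * m v = m' x := fun x => by rw [← show left v m = m' from hm]; rfl
    have hn' : ∀ x, n x * n v = m' x := fun x => by rw [← show left v n = m' from hn]; rfl
    obtain ⟨h1, -⟩ := hX (m v) (hm' v)
    refine LinearMap.ext fun x => ?_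
    calc m x = m x * m v * (m v * ↑u⁻¹) := by rw [mul_assoc, h1, mul_one]
      _ = n x * m v * (m v * ↑u⁻¹) := by rw [hm', h, hn']
      _ = n x := by rw [mul_assoc, h1, mul_one]
  · intro X (h : X * X = m' v)
    obtain ⟨h1, h2⟩ := hX X h
    refine ⟨(LinearMap.mulRight k (X * ↑u⁻¹)) ∘ₗ m', LinearMap.ext fun x => ?_, ?_⟩
    · have h3 : m' v * (X * ↑u⁻¹) = X := by rw [← h, mul_assoc, h1, mul_one]
      change m' x * (X * ↑u⁻¹) * (m' v * (X * ↑u⁻¹)) = m' x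
      rw [h3, mul_assoc, h2, mul_one]
    · change m' v * (X * ↑u⁻¹) = X
      rw [← h, mul_assoc, h1, mul_one]

/-- Flipping intertwines the two maps: `(right v m).flip = left v m.flip`. -/
theorem ncard_right_fibre (v : V) (m' : Mult k V) :
    {m : Mult k V | right v m = m'}.ncard = {m : Mult k V | left v m = m'.flip}.ncard := by
  refine Set.ncard_congr (fun m _ => m.flip) ?_ ?_ ?_
  · rintro m rfl
    rfl
  · intro m n _ _ h
    exact congrArg LinearMap.flip h
  · intro m (hm : left v m = m'.flip)
    refine ⟨m.flip, ?_, rfl⟩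
    change (left v m).flip = m'
    rw [hm, LinearMap.flip_flip]

end SquareRoots

end Homotope

namespace AffineVar

/-! ### Generic fibres and degrees of field extensions. -/

section GenericFibre

open Polynomial

/-- Any finite set of polynomials over the fraction field of `A` can be lifted to polynomials over
a localization of `A` away from a single nonzero element. -/
theorem exists_away_lifts (A : Type*) {K ι : Type*} [CommRing A] [IsDomain A] [Field K] [Algebra A K]
    [IsFractionRing A K] [Finite ι] (p : ι → K[X]) :
    ∃ g : A, g ≠ 0 ∧ ∃ j : Localization.Away g →+* K, Function.Injective j ∧
      j.comp (algebraMap A _) = algebraMap A K ∧ ∀ i, p i ∈ Polynomial.lifts j := by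
  classical
  have := Fintype.ofFinite ι
  -- `g` is a common denominator of all coefficients of all the `p i`.
  obtain ⟨⟨g, hg⟩, hint⟩ := IsLocalization.exist_integer_multiples_of_finset (nonZeroDivisors A)
    (Finset.univ.biUnion fun i => (p i).support.image (p i).coeff)
  have hg0 : g ≠ 0 := nonZeroDivisors.ne_zero hg
  have hgK : algebraMap A K g ≠ 0 :=
    (map_ne_zero_iff _ (IsFractionRing.injective A K)).mpr hg0
  let j : Localization.Away g →+* K := IsLocalization.Away.lift g hgK.isUnit
  have hj : ∀ a, j (algebraMap A _ a) = algebraMap A K a := fun a =>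
    IsLocalization.Away.lift_eq g hgK.isUnit a
  have hunit : algebraMap A (Localization.Away g) g * IsLocalization.Away.invSelf g = 1 :=
    IsLocalization.Away.mul_invSelf g
  refine ⟨g, hg0, j, ?_, RingHom.ext hj, fun i => ?_⟩
  · rw [injective_iff_map_eq_zero]
    intro z hz
    obtain ⟨n, a, ha⟩ := IsLocalization.Away.surj g z
    have h1 := congrArg j ha
    rw [map_mul, hz, zero_mul, hj] at h1
    rw [← map_zero (algebraMap A K)] at h1
    rw [← IsFractionRing.injective A K h1, map_zero, ← map_pow] at ha
    have hu : IsUnit (algebraMap A (Localization.Away g) (g ^ n)) := by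
      rw [map_pow]; exact (IsUnit.of_mul_eq_one _ hunit).pow n
    rw [map_pow] at ha hu
    exact hu.mul_left_eq_zero.mp ha
  · rw [Polynomial.lifts_iff_coeff_lifts]
    intro n
    by_cases hn : (p i).coeff n = 0
    · exact ⟨0, by rw [hn, map_zero]⟩
    · obtain ⟨a, ha⟩ := hint ((p i).coeff n) (Finset.mem_biUnion.mpr ⟨i, Finset.mem_univ _,
        Finset.mem_image_of_mem _ (Polynomial.mem_support_iff.mpr hn)⟩)
      refine ⟨algebraMap A _ a * IsLocalization.Away.invSelf g, mul_left_cancel₀ hgK ?_⟩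
      have h1 := congrArg j hunit
      rw [map_mul, hj, map_one] at h1
      rw [map_mul, hj, ha, Algebra.smul_def]
      linear_combination (algebraMap A K g * (p i).coeff n) * h1

/-- A finite separable extension of fraction fields has a primitive element in the top ring. -/
theorem exists_primitive_element_algebraMap {A B K L : Type*} [CommRing A] [IsDomain A]
    [CommRing B] [IsDomain B] [Field K] [Field L] [Algebra A B] [Algebra A K] [IsFractionRing A K]
    [Algebra B L] [IsFractionRing B L] [Algebra K L] [Algebra A L] [IsScalarTower A K L]
    [IsScalarTower A B L] [FiniteDimensional K L] [Algebra.IsSeparable K L] :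
    ∃ θ : B, IntermediateField.adjoin K {algebraMap B L θ} = ⊤ := by
  obtain ⟨α, hα⟩ := Field.exists_primitive_element K L
  obtain ⟨b, c, hc, rfl⟩ := IsFractionRing.div_surjective (A := B) α
  have hcL : algebraMap B L c ≠ 0 := (map_ne_zero_iff _ (IsFractionRing.injective B L)).mpr
    (nonZeroDivisors.ne_zero hc)
  have halg : IsAlgebraic A c := by
    have h1 : IsAlgebraic A (algebraMap B L c) :=
      (IsFractionRing.isAlgebraic_iff A K L).mpr (Algebra.IsAlgebraic.isAlgebraic _)
    exact (isAlgebraic_algebraMap_iff (IsFractionRing.injective B L)).mp h1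
  -- With `a = c * d`, the primitive element `b / c` equals `b * d / a`; as `a` lies in `K`, the
  -- numerator `b * d` is primitive too.
  obtain ⟨a, ha, d, hd⟩ := halg.exists_nonzero_dvd hc
  have haK : algebraMap A K a ≠ 0 := (map_ne_zero_iff _ (IsFractionRing.injective A K)).mpr ha
  refine ⟨b * d, ?_⟩
  rw [eq_top_iff, ← hα, IntermediateField.adjoin_simple_le_iff]
  have h1 : algebraMap B L b / algebraMap B L c =
      algebraMap K L (algebraMap A K a)⁻¹ * algebraMap B L (b * d) := by
    have h2 := congrArg (algebraMap B L) hd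
    rw [← IsScalarTower.algebraMap_apply, IsScalarTower.algebraMap_apply A K L, map_mul] at h2
    have haL : algebraMap K L (algebraMap A K a) ≠ 0 := (_root_.map_ne_zero _).mpr haK
    rw [map_inv₀, div_eq_iff hcL, map_mul]
    rw [h2] at haL ⊢
    have hdL := right_ne_zero_of_mul haL
    field_simp
  rw [h1]
  exact mul_mem (IntermediateField.algebraMap_mem _ _)
    (IntermediateField.mem_adjoin_simple_self _ _)

/-- The number of points of the generic fibre of a generically finite separable extension of
domains of finite type is the degree of the extension of fraction fields. -/
theorem exists_card_fibre_eq_finrank {k A B K L : Type*} [Field k] [IsAlgClosed k] [CommRing A]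
    [IsDomain A] [CommRing B] [IsDomain B] [Field K] [Field L] [Algebra A B] [Algebra A K]
    [IsFractionRing A K] [Algebra B L] [IsFractionRing B L] [Algebra K L] [Algebra A L]
    [IsScalarTower A K L] [IsScalarTower A B L] [FiniteDimensional K L] [Algebra.IsSeparable K L]
    [hB : Algebra.FiniteType A B] :
    ∃ g : A, g ≠ 0 ∧ ∀ y : A →+* k, y g ≠ 0 →
      Nat.card {x : B →+* k // x.comp (algebraMap A B) = y} = Module.finrank K L := by
  classical
  obtain ⟨θ, hθ⟩ := exists_primitive_element_algebraMap (A := A) (B := B) (K := K) (L := L)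
  obtain ⟨S, hS⟩ := hB.out
  set θL := algebraMap B L θ
  have hP : ∀ s : S, ∃ P : K[X], aeval θL P = algebraMap B L s := fun s => by
    have h1 : algebraMap B L s ∈ Algebra.adjoin K {θL} := by
      rw [← IntermediateField.adjoin_simple_toSubalgebra_of_isAlgebraic
        (Algebra.IsAlgebraic.isAlgebraic θL), hθ]
      trivial
    rw [Algebra.adjoin_singleton_eq_range_aeval] at h1
    exact h1
  choose P hP using hP
  have hint : IsIntegral K θL := Algebra.IsIntegral.isIntegral θL
  set μ := minpoly K θL with hμ
  have hdeg : μ.natDegree = Module.finrank K L :=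
    (Field.primitive_element_iff_minpoly_natDegree_eq K θL).mp hθ
  obtain ⟨a, b, hab⟩ := Algebra.IsSeparable.isSeparable K θL
  -- Inverting `g` clears the denominators of the expressions `P s` of the generators in `θ`, of
  -- `μ`, and of the Bézout coefficients `a`, `b`. The latter keep `μ'` separable under every
  -- specialisation.
  obtain ⟨g, hg, j, hj, hjA, hlift⟩ := exists_away_lifts A
    (Sum.elim P ![μ, a, b] : S ⊕ Fin 3 → K[X])
  have hlP : ∀ s, ∃ P' : (Localization.Away g)[X], P'.map j = P s := fun s =>
    (mem_lifts _).mp (hlift (Sum.inl s))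
  choose P' hP' using hlP
  obtain ⟨μ', hμ', hμ'deg, hμ'm⟩ := lifts_and_natDegree_eq_and_monic
    (f := j) (p := μ) (hlift (Sum.inr 0)) (minpoly.monic hint)
  obtain ⟨a', ha' : a'.map j = a⟩ := (mem_lifts _).mp (hlift (Sum.inr 1))
  obtain ⟨b', hb' : b'.map j = b⟩ := (mem_lifts _).mp (hlift (Sum.inr 2))
  have hsep : μ'.Separable := by
    refine ⟨a', b', Polynomial.map_injective j hj ?_⟩
    rw [Polynomial.map_add, Polynomial.map_mul, Polynomial.map_mul, Polynomial.map_one, ha', hb',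
      ← derivative_map, hμ', hab]
  -- Substitution of `θ`: its range contains `B` and its kernel is generated by `μ'`.
  let Ψ : (Localization.Away g)[X] →+* L := eval₂RingHom ((algebraMap K L).comp j) θL
  have hΨ : ∀ p, Ψ p = aeval θL (p.map j) := fun p => by
    simp [Ψ, aeval_def, eval₂_map]
  have hΨA : ∀ c : A, Ψ (C (algebraMap A _ c)) = algebraMap A L c := fun c => by
    have := RingHom.congr_fun hjA c
    simp only [RingHom.comp_apply] at this
    simp [Ψ, this, ← IsScalarTower.algebraMap_apply]
  have hΨB : ∀ c : B, ∃ p, Ψ p = algebraMap B L c := by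
    intro c
    have hc : c ∈ Algebra.adjoin A (S : Set B) := hS ▸ Algebra.mem_top
    induction hc using Algebra.adjoin_induction with
    | mem s hs => exact ⟨P' ⟨s, hs⟩, by rw [hΨ, hP', hP]⟩
    | algebraMap r => exact ⟨_, (hΨA r).trans (IsScalarTower.algebraMap_apply A B L r)⟩
    | add _ _ _ _ hx hy =>
      obtain ⟨p, hp⟩ := hx
      obtain ⟨q, hq⟩ := hy
      exact ⟨p + q, by rw [map_add, map_add, hp, hq]⟩
    | mul _ _ _ _ hx hy =>
      obtain ⟨p, hp⟩ := hx
      obtain ⟨q, hq⟩ := hy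
      exact ⟨p * q, by rw [map_mul, map_mul, hp, hq]⟩
  have hΨker : ∀ p, Ψ p = 0 → μ' ∣ p := fun p hp => by
    rw [← Polynomial.map_dvd_map j hj hμ'm, hμ']
    exact minpoly.dvd K θL (by rw [← hΨ, hp])
  refine ⟨g, hg, fun y hy => ?_⟩
  let y' : Localization.Away g →+* k := IsLocalization.Away.lift g (isUnit_iff_ne_zero.mpr hy)
  have hy' : ∀ c, y' (algebraMap A _ c) = y c := fun c =>
    IsLocalization.Away.lift_eq g (isUnit_iff_ne_zero.mpr hy) c
  -- Relations `p(θ) = c` survive under `x` although `p` has denominators: multiply by a power `d`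
  -- of `g`, apply `x` in `B`, and cancel `y d ≠ 0`.
  have hcompat : ∀ (x : B →+* k), x.comp (algebraMap A B) = y → ∀ p c, Ψ p = algebraMap B L c →
      eval₂ y' (x θ) p = x c := by
    intro x hx p c hpc
    obtain ⟨d, hd, hdp⟩ := IsLocalization.integerNormalization_spec (Submonoid.powers g) p
    set q := IsLocalization.integerNormalization (Submonoid.powers g) p
    have hdp' : q.map (algebraMap A (Localization.Away g)) = C (algebraMap A _ d) * p := by
      rw [hdp, ← Polynomial.smul_eq_C_mul, algebraMap_smul]
    have hyd : y d ≠ 0 := by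
      obtain ⟨n, rfl⟩ := hd
      rw [map_pow]
      exact pow_ne_zero _ hy
    have h1 : aeval θ q = algebraMap A B d * c := by
      apply IsFractionRing.injective B L
      rw [map_mul, ← hpc, ← IsScalarTower.algebraMap_apply, ← hΨA, ← map_mul, ← hdp', hΨ,
        Polynomial.map_map, hjA, aeval_map_algebraMap, aeval_algebraMap_apply]
    have h2 : eval₂ y (x θ) q = y d * x c := by
      have h3 := congrArg x h1
      rw [aeval_def, hom_eval₂, hx, map_mul] at h3
      rw [h3, ← RingHom.comp_apply, hx]
    have h3 := congrArg (eval₂ y' (x θ)) hdp'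
    rw [eval₂_map, eval₂_mul, eval₂_C, hy', RingHom.ext hy' (f := y'.comp _), h2] at h3
    exact (mul_left_cancel₀ hyd h3).symm
  have hroot : ∀ τ : k, τ ∈ (μ'.map y').rootSet k ↔ eval₂ y' τ μ' = 0 := fun τ => by
    rw [mem_rootSet, coe_aeval_eq_eval, eval_map]
    exact and_iff_right (hμ'm.map y').ne_zero
  let E : {x : B →+* k // x.comp (algebraMap A B) = y} → (μ'.map y').rootSet k := fun x =>
    ⟨x.1 θ, (hroot _).mpr (by
      rw [hcompat x.1 x.2 μ' 0, map_zero]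
      rw [hΨ, hμ', minpoly.aeval, map_zero])⟩
  have hE : Function.Bijective E := by
    constructor
    · intro x x' h
      have h1 : x.1 θ = x'.1 θ := congrArg Subtype.val h
      refine Subtype.ext (RingHom.ext fun c => ?_)
      obtain ⟨p, hp⟩ := hΨB c
      rw [← hcompat x.1 x.2 p c hp, ← hcompat x'.1 x'.2 p c hp, h1]
    · rintro ⟨τ, hτ⟩
      rw [hroot] at hτ
      -- Evaluation at a root `τ` kills `μ'`, so it descends to the range of `Ψ`; its restriction to
      -- `B` is the required point.
      have hker : RingHom.ker Ψ.rangeRestrict ≤ RingHom.ker (eval₂RingHom y' τ) := by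
        intro p hp
        rw [RingHom.ker_rangeRestrict, RingHom.mem_ker] at hp
        obtain ⟨q, rfl⟩ := hΨker p hp
        rw [RingHom.mem_ker, coe_eval₂RingHom, eval₂_mul, hτ, zero_mul]
      let F := RingHom.liftOfSurjective Ψ.rangeRestrict Ψ.rangeRestrict_surjective
        ⟨eval₂RingHom y' τ, hker⟩
      have hF : ∀ p, F (Ψ.rangeRestrict p) = eval₂ y' τ p := fun p =>
        RingHom.liftOfRightInverse_comp_apply _ _ _ _ p
      let x : B →+* k := F.comp ((algebraMap B L).codRestrict Ψ.range hΨB)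
      have hx : ∀ p c, Ψ p = algebraMap B L c → x c = eval₂ y' τ p := fun p c hpc => by
        rw [← hF]
        exact congrArg F (Subtype.ext hpc.symm)
      refine ⟨⟨x, RingHom.ext fun c => ?_⟩, Subtype.ext ?_⟩
      · rw [RingHom.comp_apply, hx (C (algebraMap A _ c)), eval₂_C, hy']
        rw [hΨA, IsScalarTower.algebraMap_apply A B L]
      · exact (hx X θ (by simp [Ψ, θL])).trans (eval₂_X _ _)
  rw [Nat.card_eq_of_bijective E hE, Nat.card_eq_fintype_card, card_rootSet_eq_natDegree hsep.map
    (IsAlgClosed.splits _), hμ'm.natDegree_map, hμ'deg, hdeg]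

end GenericFibre

end AffineVar

namespace AffineVar

universe u v

/-- The number of points of the generic fibre of a dominant morphism between varieties of the same
dimension in characteristic zero is the degree of the extension of function fields. -/
theorem exists_card_fibre_eq_finrank_of_trdeg_eq {k : Type u} {A B : Type v} [Field k]
    [IsAlgClosed k] [CharZero k] [CommRing A] [IsDomain A] [Algebra k A] [CommRing B] [IsDomain B]
    [Algebra k B] [Algebra.FiniteType k B] (φ : A →+* B) (hφ : Function.Injective φ)
    (hφk : ∀ c : k, φ (algebraMap k A c) = algebraMap k B c) {n : ℕ}
    (hB : Algebra.trdeg k B = n) (hA : Algebra.trdeg k A = n) :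
    ∃ g : A, g ≠ 0 ∧ ∀ y : A →+* k, y g ≠ 0 → Nat.card {x : B →+* k // x.comp φ = y} =
      @Module.finrank (FractionRing A) (FractionRing B) _ _
        (IsFractionRing.map (K := FractionRing A) (L := FractionRing B) hφ).toAlgebra.toModule := by
  let : Algebra A B := φ.toAlgebra
  let : Algebra (FractionRing A) (FractionRing B) := (IsFractionRing.map hφ).toAlgebra
  have : FaithfulSMul A B := (faithfulSMul_iff_algebraMap_injective _ _).mpr hφ
  have : IsScalarTower k A B := .of_algebraMap_eq fun c => (hφk c).symm
  have : IsScalarTower A (FractionRing A) (FractionRing B) := .of_algebraMap_eq fun x => by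
    rw [IsScalarTower.algebraMap_apply A B (FractionRing B)]
    exact (IsLocalization.map_eq (S := FractionRing A) (Q := FractionRing B)
      (nonZeroDivisors_le_comap_nonZeroDivisors_of_injective φ hφ) x).symm
  have : Algebra.FiniteType A B := .of_restrictScalars_finiteType k _ _
  have : FaithfulSMul k A := (faithfulSMul_iff_algebraMap_injective _ _).mpr
    (algebraMap k A).injective
  have : Algebra.IsAlgebraic A B := by
    rw [← trdeg_eq_zero_iff]
    -- Additivity of transcendence degree leaves `0` for `B` over `A`; cancelling cardinals needs
    -- `n` finite.
    have h := trdeg_add_eq k A (A := B)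
    rw [hA, hB] at h
    exact Cardinal.eq_of_add_eq_add_left (h.trans (add_zero _).symm) Cardinal.natCast_lt_aleph0
  have : Algebra.IsAlgebraic (FractionRing A) (FractionRing B) :=
    (IsFractionRing.comap_isAlgebraic_iff (A := A)).mp
      ((IsFractionRing.isAlgebraic_iff' A B _).mp inferInstance)
  have : Algebra.EssFiniteType B (FractionRing B) := .of_isLocalization _ (nonZeroDivisors B)
  have : Algebra.EssFiniteType A (FractionRing B) := .comp _ B _
  have : Algebra.EssFiniteType (FractionRing A) (FractionRing B) := .of_comp A _ _
  have : Module.Finite (FractionRing A) (FractionRing B) :=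
    Algebra.finite_of_essFiniteType_of_isAlgebraic
  have : CharZero (FractionRing A) :=
    charZero_of_injective_algebraMap (algebraMap k (FractionRing A)).injective
  exact exists_card_fibre_eq_finrank

/-! ### The Zariski topology and generic properties. -/

section Zariski

variable {k : Type*} [Field k] {W : Type*} [AddCommGroup W] [Module k W]

/-- The principal open sets form a basis of the Zariski topology. -/
theorem exists_principal_subset {U : Set W} (hU : @IsOpen W (zariski k W) U) {x : W} (hx : x ∈ U) :
    ∃ f : polyFun k W, f.1 x ≠ 0 ∧ ∀ w, f.1 w ≠ 0 → w ∈ U := by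
  induction (hU : TopologicalSpace.GenerateOpen _ U) with
  | basic s hs =>
    obtain ⟨f, hf, rfl⟩ := hs
    exact ⟨⟨f, hf⟩, hx, fun _ h => h⟩
  | univ => exact ⟨1, one_ne_zero, fun _ _ => trivial⟩
  | inter s t _ _ ihs iht =>
    obtain ⟨f, hfx, hf⟩ := ihs hx.1
    obtain ⟨g, hgx, hg⟩ := iht hx.2
    exact ⟨f * g, mul_ne_zero hfx hgx, fun w hw =>
      ⟨hf w (left_ne_zero_of_mul hw), hg w (right_ne_zero_of_mul hw)⟩⟩
  | sUnion S _ ih =>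
    obtain ⟨s, hs, hxs⟩ := hx
    obtain ⟨f, hfx, hf⟩ := ih s hs hxs
    exact ⟨f, hfx, fun w hw => ⟨s, hs, hf w hw⟩⟩

theorem polyFun_exists_ne_zero {f : polyFun k W} (hf : f ≠ 0) : ∃ w, f.1 w ≠ 0 := by
  by_contra! h
  exact hf (Subtype.ext (funext h))

/-- Affine space is irreducible: `k[W]` is a domain, so nonempty principal open sets always meet and
are therefore dense. -/
theorem generically_iff [Infinite k] {P : W → Prop} :
    Generically k W P ↔ ∃ f : polyFun k W, f ≠ 0 ∧ ∀ w, f.1 w ≠ 0 → P w := by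
  constructor
  · rintro ⟨U, hU, hd, hP⟩
    obtain ⟨x, hx⟩ := @Dense.nonempty W (zariski k W) _ ⟨0⟩ hd
    obtain ⟨f, hfx, hf⟩ := exists_principal_subset hU hx
    exact ⟨f, fun h => hfx (by rw [h]; rfl), fun w hw => hP w (hf w hw)⟩
  · rintro ⟨f, hf, hP⟩
    refine ⟨{w | f.1 w ≠ 0}, TopologicalSpace.isOpen_generateFrom_of_mem ⟨f.1, f.2, rfl⟩, ?_, hP⟩
    let := zariski k W
    rw [dense_iff_inter_open]
    rintro U hU ⟨x, hx⟩
    obtain ⟨g, hgx, hg⟩ := exists_principal_subset hU hx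
    have hg0 : g ≠ 0 := fun h => hgx (by rw [h]; rfl)
    obtain ⟨w, hw⟩ := polyFun_exists_ne_zero (mul_ne_zero hf hg0)
    exact ⟨w, hg w (right_ne_zero_of_mul hw), left_ne_zero_of_mul hw⟩

/-- Generic properties are preserved by linear automorphisms. -/
theorem Generically.comp_linearEquiv [Infinite k] {W' : Type*} [AddCommGroup W'] [Module k W']
    {P : W → Prop} (hP : Generically k W P) (e : W' ≃ₗ[k] W) :
    Generically k W' fun w => P (e w) := by
  rw [generically_iff] at hP ⊢
  obtain ⟨f, hf, hP⟩ := hP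
  obtain ⟨w, hw⟩ := polyFun_exists_ne_zero hf
  refine ⟨⟨f.1 ∘ e, regular_of_dual _ (fun φ => dual_mem_polyFun (φ ∘ₗ e.toLinearMap)) _ f.2⟩,
    fun h => hw ?_, fun w hw => hP _ hw⟩
  simpa using congrFun (congrArg Subtype.val h) (e.symm w)

end Zariski

/-! ### Points and dimension of affine space. -/

section Points

variable (k : Type*) [Field k] (W : Type*) [AddCommGroup W] [Module k W]

/-- Evaluation of polynomial functions at a point. -/
def evalAt (w : W) : polyFun k W →ₐ[k] k :=
  (Pi.evalAlgHom k (fun _ : W => k) w).comp (polyFun k W).val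

/-- A linear functional as a polynomial function. -/
def linFun : Module.Dual k W →ₗ[k] polyFun k W where
  toFun φ := ⟨φ, dual_mem_polyFun φ⟩
  map_add' _ _ := rfl
  map_smul' _ _ := rfl

variable {k W}

@[simp] theorem evalAt_apply (w : W) (f : polyFun k W) : evalAt k W w f = f.1 w := rfl

theorem polyFun_algHom_ext {R : Type*} [Semiring R] [Algebra k R] {χ ψ : polyFun k W →ₐ[k] R}
    (h : ∀ φ, χ (linFun k W φ) = ψ (linFun k W φ)) : χ = ψ := by
  refine AlgHom.adjoin_ext ?_
  rintro _ ⟨φ, rfl⟩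
  exact h φ

/-- The algebra homomorphisms from `k[W]` to `k` are the points of `W`. -/
theorem evalAt_bijective [FiniteDimensional k W] : Function.Bijective (evalAt k W) := by
  constructor
  · intro w w' h
    refine (Module.evalEquiv k W).injective (LinearMap.ext fun φ => ?_)
    exact AlgHom.congr_fun h (linFun k W φ)
  · intro χ
    -- The restriction of `χ` to linear functionals lies in the double dual of `W`, hence is
    -- evaluation at a point.
    refine ⟨(Module.evalEquiv k W).symm (χ.toLinearMap ∘ₗ linFun k W), polyFun_algHom_ext fun φ => ?_⟩
    exact Module.apply_evalEquiv_symm_apply k W φ _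

variable (k W) in
/-- The linear coordinates on `W`, as polynomial functions. -/
noncomputable def coordFun [FiniteDimensional k W] (i : Fin (Module.finrank k W)) : polyFun k W :=
  linFun k W ((Module.finBasis k W).coord i)

theorem adjoin_coordFun [FiniteDimensional k W] :
    Algebra.adjoin k (Set.range (coordFun k W)) = ⊤ := by
  have hlin : ∀ φ, linFun k W φ ∈ Algebra.adjoin k (Set.range (coordFun k W)) := by
    intro φ
    rw [← (Module.finBasis k W).sum_dual_apply_smul_coord φ, map_sum]
    refine sum_mem fun i _ => ?_
    rw [map_smul]
    exact Subalgebra.smul_mem _ (Algebra.subset_adjoin (Set.mem_range_self i)) _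
  have htop : (⊤ : Subalgebra k (polyFun k W)) = Algebra.adjoin k
      (Subtype.val ⁻¹' Set.range fun φ : Module.Dual k W => (φ : W → k)) :=
    (Algebra.adjoin_adjoin_coe_preimage (R := k)).symm
  refine top_le_iff.mp (htop.le.trans (Algebra.adjoin_le ?_))
  intro x hx
  obtain ⟨φ, hφ⟩ := Set.mem_preimage.mp hx
  rw [show x = linFun k W φ from Subtype.ext hφ.symm]
  exact hlin φ

instance polyFun_finiteType [FiniteDimensional k W] : Algebra.FiniteType k (polyFun k W) :=
  ⟨⟨(Set.finite_range (coordFun k W)).toFinset, by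
    rw [Set.Finite.coe_toFinset, adjoin_coordFun]⟩⟩

theorem algebraicIndependent_coordFun [Infinite k] [FiniteDimensional k W] :
    AlgebraicIndependent k (coordFun k W) := by
  rw [algebraicIndependent_iff]
  intro p hp
  refine MvPolynomial.funext fun t => ?_
  have h := congrArg (evalAt k W ((Module.finBasis k W).equivFun.symm t)) hp
  rw [← AlgHom.comp_apply, MvPolynomial.comp_aeval, map_zero] at h
  rw [map_zero, ← h, MvPolynomial.aeval_eq_eval]
  congr 2
  funext i
  simp [coordFun, linFun, Finsupp.single_apply]

theorem isTranscendenceBasis_coordFun [Infinite k] [FiniteDimensional k W] :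
    IsTranscendenceBasis k (coordFun k W) := by
  rw [isTranscendenceBasis_iff_algebraicIndependent_isAlgebraic]
  refine ⟨algebraicIndependent_coordFun, ⟨fun a => ?_⟩⟩
  have ha : a ∈ Algebra.adjoin k (Set.range (coordFun k W)) := by
    rw [adjoin_coordFun]
    trivial
  exact isAlgebraic_algebraMap (⟨a, ha⟩ : Algebra.adjoin k (Set.range (coordFun k W)))

end Points

/-! ### Degree of a morphism from its generic fibres. -/

section Degree

variable {k : Type u} [Field k] {W W' : Type v} [AddCommGroup W] [Module k W] [AddCommGroup W']
  [Module k W'] [FiniteDimensional k W] [FiniteDimensional k W']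

theorem trdeg_polyFun [Infinite k] :
    Algebra.trdeg k (polyFun k W) = Module.finrank k W := by
  have := (isTranscendenceBasis_coordFun (k := k) (W := W)).lift_cardinalMk_eq_trdeg
  simpa using this.symm

/-- The generic fibre of a dominant morphism between affine spaces of the same dimension in
characteristic zero has as many points as the degree of the morphism. -/
theorem Morphism.generically_ncard_fibre [IsAlgClosed k] [CharZero k] (F : Morphism k W W')
    (hF : F.IsDominant) (hdim : Module.finrank k W = Module.finrank k W') :
    Generically k W' fun w' => {w | F.toFun w = w'}.ncard = F.degree hF := by
  obtain ⟨g, hg, hcard⟩ := exists_card_fibre_eq_finrank_of_trdeg_eq F.comorphism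
    hF.comorphism_injective (fun _ : k => rfl) ((trdeg_polyFun (k := k) (W := W)).trans (congrArg _ hdim))
    (trdeg_polyFun (k := k) (W := W'))
  refine generically_iff.mpr ⟨g, hg, fun w' hw' => ?_⟩
  refine Eq.trans ?_ (hcard (evalAt k W' w').toRingHom hw')
  rw [← Nat.card_coe_set_eq]
  have hcomp : ∀ w : W, (evalAt k W w).toRingHom.comp F.comorphism =
      (evalAt k W' (F.toFun w)).toRingHom := fun _ => rfl
  refine Nat.card_eq_of_bijective (fun w => ⟨(evalAt k W w.1).toRingHom,
    (hcomp _).trans (by rw [show F.toFun w = w' from w.2])⟩)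
    ⟨?_, ?_⟩
  · intro w₁ w₂ h
    refine Subtype.ext (evalAt_bijective (k := k).1 (AlgHom.ext fun f => ?_))
    exact RingHom.congr_fun (congrArg Subtype.val h) f
  · rintro ⟨x, hx⟩
    -- A ring homomorphism lying over the `k`-point `w'` is automatically `k`-linear.
    let χ : polyFun k W →ₐ[k] k :=
      { x with
        commutes' := fun c => (RingHom.congr_fun hx (algebraMap k _ c)).trans
          ((evalAt k W' w').commutes c) }
    obtain ⟨w, hw⟩ := evalAt_bijective.2 χ
    have hwx : (evalAt k W w).toRingHom = x := by rw [hw]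
    refine ⟨⟨w, evalAt_bijective (k := k).1 (AlgHom.ext fun f => ?_)⟩, Subtype.ext hwx⟩
    rw [← hwx, hcomp] at hx
    exact RingHom.congr_fun hx f

/-- A morphism between affine spaces of the same dimension whose generic fibres have exactly
`n > 0` points is dominant of degree `n`. -/
theorem Morphism.degree_eq_of_generically [IsAlgClosed k] [CharZero k] (F : Morphism k W W')
    (hdim : Module.finrank k W = Module.finrank k W') {n : ℕ} (hn : n ≠ 0)
    (h : Generically k W' fun w' => {w | F.toFun w = w'}.ncard = n) :
    ∃ hF : F.IsDominant, F.degree hF = n := by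
  have hF : F.IsDominant := by
    obtain ⟨U, -, hd, hU⟩ := h
    refine @Dense.mono W' (zariski k W') _ _ (fun w' hw' => ?_) hd
    obtain ⟨w, hw⟩ := Set.nonempty_of_ncard_ne_zero ((hU w' hw').trans_ne hn)
    exact ⟨w, hw⟩
  refine ⟨hF, ?_⟩
  obtain ⟨f, hf, hf'⟩ := generically_iff.mp h
  obtain ⟨g, hg, hg'⟩ := generically_iff.mp (F.generically_ncard_fibre hF hdim)
  -- At a common point of the two dense open sets, both values of the fibre cardinality hold.
  obtain ⟨w, hw⟩ := polyFun_exists_ne_zero (mul_ne_zero hf hg)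
  rw [← hf' w (left_ne_zero_of_mul hw), hg' w (right_ne_zero_of_mul hw)]

end Degree

end AffineVar

namespace Homotope

/-! ### Generic multiplications. -/

section Generic

open AffineVar

variable {k V : Type*} [Field k] [AddCommGroup V] [Module k V] [FiniteDimensional k V]

/-- The sizes `n` and `n - 1` are fixed so that the resultant commutes with specialisation;
characteristic zero makes `n - 1` the true degree of the derivative. -/
theorem resultant_derivative_ne_zero_iff {K : Type*} [Field K] [CharZero K] {p : Polynomial K}
    {n : ℕ} (hp : p ≠ 0) (hn : p.natDegree = n) :
    p.resultant p.derivative n (n - 1) ≠ 0 ↔ p.Separable := by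
  have h : p.derivative.natDegree = n - 1 := by rw [Polynomial.natDegree_derivative, hn]
  rw [← h, ← hn, Ne, Polynomial.resultant_eq_zero_iff, Polynomial.Separable]
  tauto

/-- A generic multiplication `m` is such that `m v` is invertible with separable characteristic
polynomial. -/
theorem generically_separable [CharZero k] (v : V) (hv : v ≠ 0) :
    Generically k (Mult k V) fun m =>
      (m v).charpoly.Separable ∧ LinearMap.det (m v) ≠ 0 := by
  classical
  have : Infinite k := .of_injective _ (Nat.cast_injective (R := k))
  let n := Module.finrank k V
  let b : Module.Basis (Fin n) k V := Module.finBasis k V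
  let entry (i j : Fin n) : Module.Dual k (Mult k V) :=
    { toFun := fun m => b.coord i (m v (b j))
      map_add' := fun _ _ => by simp
      map_smul' := fun _ _ => by simp }
  let M : Matrix (Fin n) (Fin n) (polyFun k (Mult k V)) := fun i j => linFun k _ (entry i j)
  have hM : ∀ m, (evalAt k (Mult k V) m).toRingHom.mapMatrix M = LinearMap.toMatrix b b (m v) := by
    intro m
    ext i j
    rw [LinearMap.toMatrix_apply]
    rfl
  have hMχ : ∀ m, M.charpoly.map (evalAt k (Mult k V) m).toRingHom = (m v).charpoly := by
    intro m
    rw [← LinearMap.charpoly_toMatrix (m v) b, ← hM, ← Matrix.charpoly_map]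
    rfl
  -- Up to sign, the discriminant of the characteristic polynomial times the determinant, as a
  -- polynomial function of `m`.
  let f : polyFun k (Mult k V) := M.charpoly.resultant M.charpoly.derivative n (n - 1) * M.det
  have hf : ∀ m, f.1 m = (m v).charpoly.resultant (m v).charpoly.derivative n (n - 1) *
      LinearMap.det (m v) := by
    intro m
    have h1 : f.1 m = (evalAt k (Mult k V) m).toRingHom f := rfl
    rw [h1, map_mul, ← Polynomial.resultant_map_map, ← Polynomial.derivative_map, hMχ,
      RingHom.map_det, hM, LinearMap.det_toMatrix]
  refine generically_iff.mpr ⟨f, ?_, fun m hm => ?_⟩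
  · obtain ⟨φ, hφ⟩ : ∃ φ : Module.Dual k V, φ v = 1 := by
      obtain ⟨ψ, hψ⟩ : ∃ ψ : Module.Dual k V, ψ v ≠ 0 := by
        by_contra! h
        exact hv ((Module.forall_dual_apply_eq_zero_iff k v).mp h)
      exact ⟨(ψ v)⁻¹ • ψ, inv_mul_cancel₀ hψ⟩
    -- To see `f ≠ 0`, take `m x = φ x • D` with `D` diagonal with entries `1, …, n`; the shift by
    -- one keeps the eigenvalues nonzero, and `φ v = 1` gives `m v = D`.
    let c : Fin n → k := fun i => (i : ℕ) + 1
    have hc : Function.Injective c := fun i j h => by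
      simpa [c, Fin.ext_iff] using h
    let D : Module.End k V := Matrix.toLin b b (Matrix.diagonal c)
    let m : Mult k V := φ.smulRight D
    have hmv : m v = D := by simp [m, hφ]
    have hχ : D.charpoly = ∏ i, (Polynomial.X - Polynomial.C (c i)) := by
      rw [← LinearMap.charpoly_toMatrix D b, LinearMap.toMatrix_toLin,
        Matrix.charpoly_of_isUpperTriangular _ (Matrix.blockTriangular_diagonal c)]
      simp
    have hdet : LinearMap.det D = ∏ i, c i := by
      rw [← LinearMap.det_toMatrix b, LinearMap.toMatrix_toLin, Matrix.det_diagonal]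
    intro h0
    have h1 := hf m
    rw [h0, hmv, hdet] at h1
    refine mul_ne_zero ?_ ?_ h1.symm
    · rw [resultant_derivative_ne_zero_iff D.charpoly_monic.ne_zero D.charpoly_natDegree, hχ]
      exact Polynomial.separable_prod_X_sub_C_iff.mpr hc
    · exact Finset.prod_ne_zero_iff.mpr fun i _ => Nat.cast_add_one_ne_zero _
  · rw [hf] at hm
    exact ⟨(resultant_derivative_ne_zero_iff (LinearMap.charpoly_monic _).ne_zero
      (LinearMap.charpoly_natDegree _)).mp (left_ne_zero_of_mul hm), right_ne_zero_of_mul hm⟩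

theorem generically_ncard_left [IsAlgClosed k] [CharZero k] (v : V) (hv : v ≠ 0) :
    Generically k (Mult k V) fun m' =>
      {m : Mult k V | left v m = m'}.ncard = 2 ^ Module.finrank k V := by
  obtain ⟨f, hf, h⟩ := generically_iff.mp (generically_separable (k := k) v hv)
  refine generically_iff.mpr ⟨f, hf, fun m' hm' => ?_⟩
  rw [ncard_left_fibre v m' (h m' hm').2, ncard_sqrt _ (h m' hm').1 (h m' hm').2]

theorem generically_ncard_right [IsAlgClosed k] [CharZero k] (v : V) (hv : v ≠ 0) :
    Generically k (Mult k V) fun m' =>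
      {m : Mult k V | right v m = m'}.ncard = 2 ^ Module.finrank k V := by
  simp_rw [ncard_right_fibre]
  exact (generically_ncard_left v hv).comp_linearEquiv LinearMap.lflip

end Generic

end Homotope

theorem mainTheorem8 {k : Type*} [Field k] [IsAlgClosed k] [CharZero k]
    {V : Type*} [AddCommGroup V] [Module k V] [FiniteDimensional k V]
    (v : V) (hv : v ≠ 0) :
    (∃ hL : (Homotope.L (k := k) v).IsDominant,
      (Homotope.L (k := k) v).degree hL = 2 ^ Module.finrank k V) ∧
    (∃ hR : (Homotope.R (k := k) v).IsDominant,
      (Homotope.R (k := k) v).degree hR = 2 ^ Module.finrank k V) ∧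
    AffineVar.Generically k (Homotope.Mult k V)
      (fun m' => {m : Homotope.Mult k V | Homotope.left v m = m'}.ncard
        = 2 ^ Module.finrank k V) ∧
    AffineVar.Generically k (Homotope.Mult k V)
      (fun m' => {m : Homotope.Mult k V | Homotope.right v m = m'}.ncard
        = 2 ^ Module.finrank k V) :=
  have hL := Homotope.generically_ncard_left (k := k) v hv
  have hR := Homotope.generically_ncard_right (k := k) v hv
  ⟨(Homotope.L v).degree_eq_of_generically rfl (by positivity) hL,
    (Homotope.R v).degree_eq_of_generically rfl (by positivity) hR, hL, hR⟩
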